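/- Let $n\ge 1$, let $\mathbb{B}^n$ be the open unit ball of $\mathbb{R}^n$, and for $x,y\in\mathbb{B}^n$ let $$T_x(y)=\frac{(1+2x\cdot y+|y|^2)\,x+(1-|x|^2)\,y}{1+2x\cdot y+|x|^2|y|^2}$$ be the Möbius translation of the ball. Let $g:[0,1)\to\mathbb{R}$ be continuous with $g(0)=0$, and define $v:\mathbb{B}^n\to\mathbb{R}^n$ by $v(y)=g(|y|)\,y/|y|$ for $y\neq 0$ and $v(0)=0$. Let $\Omega$ be an open set with compact closure in $\mathbb{B}^n$, and let $f$ be a nonnegative measurable function on $\Omega$ with $0<\int_\Omega f(y)(1-|y|^2)^{-n}\,dy<\infty$. Suppose $\int_0^1 g(r)(1-r^2)^{-1}\,dr=\infty$, meaning $\int_0^\rho g(r)(1-r^2)^{-1}\,dr\to\infty$ as $\rho\to 1^-$. Then for every $x\in\mathbb{B}^n$ the function $y\mapsto v(T_x(y))f(y)(1-|y|^2)^{-n}$ is integrable on $\Omega$, and a point $x\in\mathbb{B}^n$ exists such that $$\int_\Omega v(T_x(y))\,f(y)\,(1-|y|^2)^{-n}\,dy=0 .$$ If in addition $g$ is (not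 necessarily strictly) increasing with $g(r)>0$ whenever $0<r<1$, and either $n\ge 2$ or $g$ is strictly increasing, then the point $x\in\mathbb{B}^n$ is unique. -/

import Mathlib

open Set Filter Topology MeasureTheory

noncomputable section

/-- The Möbius translation `T_x(y)` of the unit ball of `ℝⁿ`; the denominator is positive
for `‖x‖ < 1` and `‖y‖ ≤ 1`. -/
def moebius {n : ℕ} (x y : EuclideanSpace ℝ (Fin n)) : EuclideanSpace ℝ (Fin n) :=
  (1 + 2 * inner ℝ x y + ‖x‖ ^ 2 * ‖y‖ ^ 2)⁻¹ •
    ((1 + 2 * inner ℝ x y + ‖y‖ ^ 2) • x + (1 - ‖x‖ ^ 2) • y)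

/-- The radial vector field `v(y) = g(|y|) y / |y|` for `y ≠ 0`, and `v(0) = 0`. -/
def radialField {n : ℕ} (g : ℝ → ℝ) (y : EuclideanSpace ℝ (Fin n)) : EuclideanSpace ℝ (Fin n) :=
  (g ‖y‖ / ‖y‖) • y

theorem radialField_zero {n : ℕ} (g : ℝ → ℝ) :
    radialField g (0 : EuclideanSpace ℝ (Fin n)) = 0 := by
  simp [radialField]

/-- The volume factor `(1 - |y|²)⁻ⁿ` of the hyperbolic ball. -/
def hypDensity {n : ℕ} (y : EuclideanSpace ℝ (Fin n)) : ℝ :=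
  (1 - ‖y‖ ^ 2) ^ (-(n : ℤ))

end

/-!
The points in question are the critical points of an energy in the hyperbolic metric of the ball.
Let `G` be the primitive of `g(r) (1 - r ^ 2)⁻¹` with `G(0) = 0`. As a function of `x`, the
potential `G(‖moebius x y‖)` depends on the hyperbolic distance from `x` to `-y` only, and its
Euclidean gradient is `(1 - ‖x‖ ^ 2)⁻¹ • radialField g (moebius x y)`
(`hasDerivAt_radialPotential_moebius`). Hence the integral in question vanishes exactly at the
critical points of `energy`, the integral of the potential against the weight.

Existence: as `x` tends to the unit sphere, `‖moebius x y‖` tends to `1` uniformly for `y ∈ Ω`, so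
the divergence of `G` makes the energy coercive (`exists_lt_energy`). It therefore attains its
minimum inside the ball, where the gradient vanishes.

Uniqueness: for increasing `g` the potential is convex along hyperbolic geodesics, strictly so
unless `-y` lies on the geodesic in question. Only the resulting monotonicity of the directional
derivative between the endpoints `x₁ ≠ x₂` of a geodesic segment is needed, and this is a statement
about the hyperbolic triangle with vertices `x₁`, `x₂`, `-y` which follows from the law of cosines
and the nonnegativity of a Gram determinant (`radial_speed_add_neg`, `inner_radialField_add_neg`).
The inequality is strict off the geodesic, that is, for almost every `y` if `2 ≤ n`
(`ae_hypGram_pos`), and for every `y` if `g` is strictly increasing. If the integral vanished at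
both `x₁` and `x₂`, integrating the strict inequality would force the weight to vanish almost
everywhere.
-/

/-! ### Elementary identities for Möbius translations -/

section Moebius

variable {n : ℕ} {x y : EuclideanSpace ℝ (Fin n)}

/-- The denominator of `moebius x y`. -/
noncomputable def moebiusDenom (x y : EuclideanSpace ℝ (Fin n)) : ℝ :=
  1 + 2 * inner ℝ x y + ‖x‖ ^ 2 * ‖y‖ ^ 2

theorem sq_one_sub_le_moebiusDenom (x y : EuclideanSpace ℝ (Fin n)) :
    (1 - ‖x‖ * ‖y‖) ^ 2 ≤ moebiusDenom x y := by
  have := neg_le_of_abs_le (abs_real_inner_le_norm x y)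
  unfold moebiusDenom
  nlinarith

theorem moebiusDenom_le_four (hx : ‖x‖ ≤ 1) (hy : ‖y‖ ≤ 1) : moebiusDenom x y ≤ 4 := by
  have h1 := le_of_abs_le (abs_real_inner_le_norm x y)
  have h2 : ‖x‖ * ‖y‖ ≤ 1 := mul_le_one₀ hx (norm_nonneg y) hy
  have h3 : 0 ≤ ‖x‖ * ‖y‖ := by positivity
  unfold moebiusDenom
  nlinarith

theorem moebiusDenom_pos (hx : ‖x‖ < 1) (hy : ‖y‖ < 1) : 0 < moebiusDenom x y := by
  have : ‖x‖ * ‖y‖ < 1 := mul_lt_one_of_nonneg_of_lt_one_left (norm_nonneg x) hx hy.le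
  exact lt_of_lt_of_le (pow_pos (sub_pos.2 this) 2) (sq_one_sub_le_moebiusDenom x y)

theorem one_sub_norm_sq_pos (hx : ‖x‖ < 1) : 0 < 1 - ‖x‖ ^ 2 := by
  nlinarith [norm_nonneg x]

/-- The numerator of `moebius x y`. -/
noncomputable def moebiusNum (x y : EuclideanSpace ℝ (Fin n)) : EuclideanSpace ℝ (Fin n) :=
  (1 + 2 * inner ℝ x y + ‖y‖ ^ 2) • x + (1 - ‖x‖ ^ 2) • y

theorem moebius_eq (x y : EuclideanSpace ℝ (Fin n)) :
    moebius x y = (moebiusDenom x y)⁻¹ • moebiusNum x y := rfl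

theorem norm_sq_moebiusNum (x y : EuclideanSpace ℝ (Fin n)) :
    ‖moebiusNum x y‖ ^ 2 =
      moebiusDenom x y * (moebiusDenom x y - (1 - ‖x‖ ^ 2) * (1 - ‖y‖ ^ 2)) := by
  rw [← real_inner_self_eq_norm_sq]
  simp only [moebiusNum, moebiusDenom, inner_add_left, inner_add_right, real_inner_smul_left,
    real_inner_smul_right, real_inner_self_eq_norm_sq, real_inner_comm x y, norm_smul, mul_pow,
    Real.norm_eq_abs, sq_abs]
  ring

theorem one_sub_norm_sq_moebius (hx : ‖x‖ < 1) (hy : ‖y‖ < 1) :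
    1 - ‖moebius x y‖ ^ 2 = (1 - ‖x‖ ^ 2) * (1 - ‖y‖ ^ 2) / moebiusDenom x y := by
  have hd := moebiusDenom_pos hx hy
  rw [moebius_eq, norm_smul, mul_pow, norm_sq_moebiusNum, Real.norm_eq_abs, sq_abs]
  field_simp
  ring

theorem norm_moebius_lt_one (hx : ‖x‖ < 1) (hy : ‖y‖ < 1) : ‖moebius x y‖ < 1 := by
  have h : 0 < 1 - ‖moebius x y‖ ^ 2 := by
    rw [one_sub_norm_sq_moebius hx hy]
    exact div_pos (mul_pos (one_sub_norm_sq_pos hx) (one_sub_norm_sq_pos hy))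
      (moebiusDenom_pos hx hy)
  nlinarith [norm_nonneg (moebius x y)]

/-- Möbius translations by points of a compact subset of the ball map compact subsets of the ball
into a common compact subset. -/
theorem exists_norm_moebius_le {ρ R₀ : ℝ} (hρ : 0 ≤ ρ) (hρ1 : ρ < 1) (hR₀ : 0 ≤ R₀)
    (hR₀1 : R₀ < 1) :
    ∃ R < 1, ∀ x y : EuclideanSpace ℝ (Fin n), ‖x‖ ≤ ρ → ‖y‖ ≤ R₀ → ‖moebius x y‖ ≤ R := by
  have hp : 0 < (1 - ρ ^ 2) * (1 - R₀ ^ 2) := mul_pos (by nlinarith) (by nlinarith)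
  refine ⟨√(1 - (1 - ρ ^ 2) * (1 - R₀ ^ 2) / 4), ?_, fun x y hx hy => ?_⟩
  · rw [Real.sqrt_lt' one_pos]
    linarith
  · have hx1 := hx.trans_lt hρ1
    have hy1 := hy.trans_lt hR₀1
    apply Real.le_sqrt_of_sq_le
    have h1 := one_sub_norm_sq_moebius hx1 hy1
    have h2 : (1 - ρ ^ 2) * (1 - R₀ ^ 2) / 4 ≤
        (1 - ‖x‖ ^ 2) * (1 - ‖y‖ ^ 2) / moebiusDenom x y := by
      apply div_le_div₀ (mul_pos (one_sub_norm_sq_pos hx1) (one_sub_norm_sq_pos hy1)).le _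
        (moebiusDenom_pos hx1 hy1) (moebiusDenom_le_four hx1.le hy1.le)
      have : ‖y‖ ^ 2 ≤ R₀ ^ 2 := by gcongr
      have : ‖x‖ ^ 2 ≤ ρ ^ 2 := by gcongr
      apply mul_le_mul <;> nlinarith
    linarith

/-- As `x` tends to the unit sphere, so does `moebius x y`, uniformly for `y` in a compact subset
of the ball. -/
theorem one_sub_norm_sq_moebius_le {R₀ : ℝ} (hR₀ : R₀ < 1) (hx : ‖x‖ < 1) (hy : ‖y‖ ≤ R₀) :
    1 - ‖moebius x y‖ ^ 2 ≤ (1 - ‖x‖ ^ 2) / (1 - R₀) ^ 2 := by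
  have hy1 := hy.trans_lt hR₀
  have hx' := one_sub_norm_sq_pos hx
  rw [one_sub_norm_sq_moebius hx hy1]
  have h : (1 - R₀) ^ 2 ≤ moebiusDenom x y := by
    refine le_trans ?_ (sq_one_sub_le_moebiusDenom x y)
    have : ‖x‖ * ‖y‖ ≤ R₀ :=
      (mul_le_of_le_one_left (norm_nonneg y) hx.le).trans hy
    gcongr
  apply div_le_div₀ hx'.le _ (pow_pos (sub_pos.2 hR₀) 2) h
  nlinarith [sq_nonneg ‖y‖]

theorem continuous_moebiusDenom :
    Continuous fun p : EuclideanSpace ℝ (Fin n) × EuclideanSpace ℝ (Fin n) =>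
      moebiusDenom p.1 p.2 := by
  unfold moebiusDenom
  fun_prop

theorem continuousOn_moebius :
    ContinuousOn (fun p : EuclideanSpace ℝ (Fin n) × EuclideanSpace ℝ (Fin n) =>
      moebius p.1 p.2) (Metric.ball 0 1 ×ˢ Metric.ball 0 1) := by
  simp only [moebius_eq]
  refine (continuous_moebiusDenom.continuousOn.inv₀ fun p hp => ?_).smul ?_
  · exact (moebiusDenom_pos (mem_ball_zero_iff.1 hp.1) (mem_ball_zero_iff.1 hp.2)).ne'
  · unfold moebiusNum
    fun_prop

theorem mapsTo_moebius :
    MapsTo (fun p : EuclideanSpace ℝ (Fin n) × EuclideanSpace ℝ (Fin n) =>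
      moebius p.1 p.2) (Metric.ball 0 1 ×ˢ Metric.ball 0 1) (Metric.ball 0 1) := fun _ hp =>
  mem_ball_zero_iff.2
    (norm_moebius_lt_one (mem_ball_zero_iff.1 hp.1) (mem_ball_zero_iff.1 hp.2))

theorem differentiableAt_moebius_left (hx : ‖x‖ < 1) (hy : ‖y‖ < 1) :
    DifferentiableAt ℝ (fun z => moebius z y) x := by
  have hd : moebiusDenom x y ≠ 0 := (moebiusDenom_pos hx hy).ne'
  have h1 : DifferentiableAt ℝ (fun z : EuclideanSpace ℝ (Fin n) => ‖z‖ ^ 2) x :=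
    differentiableAt_id.norm_sq ℝ
  have h2 : DifferentiableAt ℝ (fun z : EuclideanSpace ℝ (Fin n) => (inner ℝ z y : ℝ)) x :=
    differentiableAt_id.inner ℝ (differentiableAt_const y)
  have h3 : DifferentiableAt ℝ (fun z => moebiusDenom z y) x := by
    unfold moebiusDenom
    fun_prop
  have h4 : DifferentiableAt ℝ (fun z => moebiusNum z y) x := by
    unfold moebiusNum
    fun_prop
  exact (h3.inv hd).smul h4

/-- The derivative of `‖moebius z y‖ ^ 2 / 2` in `z`, paired with the direction `u`. It expresses
that the hyperbolic gradient of the distance function is the unit radial vector. -/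
theorem inner_moebius_deriv {u c' : EuclideanSpace ℝ (Fin n)} (hx : ‖x‖ < 1) (hy : ‖y‖ < 1)
    (hc : HasDerivAt (fun s : ℝ => moebius (x + s • u) y) c' 0) :
    inner ℝ (moebius x y) c' =
      (1 - ‖moebius x y‖ ^ 2) / (1 - ‖x‖ ^ 2) * inner ℝ (moebius x y) u := by
  have hd := moebiusDenom_pos hx hy
  have hx' := one_sub_norm_sq_pos hx
  have hl : HasDerivAt (fun s : ℝ => x + s • u) u 0 := by
    simpa using ((hasDerivAt_id (0 : ℝ)).smul_const u).const_add x
  have hlx : HasDerivAt (fun s : ℝ => ‖x + s • u‖ ^ 2) (2 * inner ℝ x u) 0 := by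
    simpa using hl.norm_sq
  have hly : HasDerivAt (fun s : ℝ => (inner ℝ (x + s • u) y : ℝ)) (inner ℝ u y) 0 := by
    simpa using hl.inner ℝ (hasDerivAt_const (0 : ℝ) y)
  have hden : HasDerivAt (fun s : ℝ => moebiusDenom (x + s • u) y)
      (2 * inner ℝ u y + 2 * inner ℝ x u * ‖y‖ ^ 2) 0 := by
    unfold moebiusDenom
    exact ((hly.const_mul 2).const_add 1).add (hlx.mul_const _)
  have hnum : HasDerivAt (fun s : ℝ => (1 - ‖x + s • u‖ ^ 2) * (1 - ‖y‖ ^ 2))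
      (-(2 * inner ℝ x u) * (1 - ‖y‖ ^ 2)) 0 := (hlx.const_sub 1).mul_const _
  have hq := (hnum.div hden (by simpa using hd.ne')).const_sub 1
  have hev : (fun s : ℝ => ‖moebius (x + s • u) y‖ ^ 2) =ᶠ[𝓝 0] fun s =>
      1 - (1 - ‖x + s • u‖ ^ 2) * (1 - ‖y‖ ^ 2) / moebiusDenom (x + s • u) y := by
    have : ∀ᶠ s : ℝ in 𝓝 0, ‖x + s • u‖ < 1 :=
      (by fun_prop : Continuous fun s : ℝ => ‖x + s • u‖).continuousAt.eventually_lt_const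
        (by simpa using hx)
    filter_upwards [this] with s hs
    rw [← one_sub_norm_sq_moebius hs hy]
    ring
  have huniq := hc.norm_sq.unique (hq.congr_of_eventuallyEq hev)
  simp only [zero_smul, add_zero] at huniq
  have h2 : (inner ℝ (moebius x y) u : ℝ) = (moebiusDenom x y)⁻¹ *
      ((1 + 2 * inner ℝ x y + ‖y‖ ^ 2) * inner ℝ x u + (1 - ‖x‖ ^ 2) * inner ℝ u y) := by
    rw [moebius_eq, moebiusNum, real_inner_smul_left, inner_add_left, real_inner_smul_left,
      real_inner_smul_left, real_inner_comm u y]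
  rw [h2, one_sub_norm_sq_moebius hx hy]
  have h3 : (inner ℝ (moebius x y) c' : ℝ) = (1 / 2) * (2 * inner ℝ (moebius x y) c') := by ring
  rw [h3, huniq]
  have hexp : moebiusDenom x y = 1 + 2 * inner ℝ x y + ‖x‖ ^ 2 * ‖y‖ ^ 2 := rfl
  field_simp
  rw [hexp]
  ring

end Moebius

/-! ### The radial field and its potential -/

section Radial

variable {n : ℕ} {g : ℝ → ℝ}

theorem norm_radialField (hg0 : g 0 = 0) (z : EuclideanSpace ℝ (Fin n)) :
    ‖radialField g z‖ = |g ‖z‖| := by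
  rcases eq_or_ne z 0 with rfl | hz
  · simp [radialField, hg0]
  · have : ‖z‖ ≠ 0 := norm_ne_zero_iff.2 hz
    rw [radialField, norm_smul, Real.norm_eq_abs, abs_div, abs_norm, div_mul_cancel₀ _ this]

theorem mapsTo_norm_ball :
    MapsTo (fun z : EuclideanSpace ℝ (Fin n) => ‖z‖) (Metric.ball 0 1) (Ico 0 1) := fun z hz =>
  ⟨norm_nonneg z, mem_ball_zero_iff.1 hz⟩

theorem continuousOn_radialField (hg : ContinuousOn g (Ico 0 1)) (hg0 : g 0 = 0) :
    ContinuousOn (radialField g : EuclideanSpace ℝ (Fin n) → _) (Metric.ball 0 1) := by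
  have hgn : ContinuousOn (fun z : EuclideanSpace ℝ (Fin n) => g ‖z‖) (Metric.ball 0 1) :=
    hg.comp continuous_norm.continuousOn mapsTo_norm_ball
  intro z hz
  rcases eq_or_ne z 0 with rfl | hz0
  · rw [ContinuousWithinAt, radialField_zero, tendsto_zero_iff_norm_tendsto_zero]
    simp only [norm_radialField hg0]
    have := (hgn 0 hz).abs
    rw [ContinuousWithinAt] at this
    simpa [hg0] using this
  · exact ((hgn z hz).div continuous_norm.continuousWithinAt (norm_ne_zero_iff.2 hz0)).smul
      continuousWithinAt_id

/-- The function of `r` whose composition with the norm is a potential of the radial field in the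
hyperbolic metric. The even extension of `g` makes it differentiable on all of `(-1, 1)`. -/
noncomputable def radialPotential (g : ℝ → ℝ) (r : ℝ) : ℝ :=
  ∫ t in (0 : ℝ)..r, g |t| * (1 - t ^ 2)⁻¹

theorem hasDerivAt_radialPotential (hg : ContinuousOn g (Ico 0 1)) {r : ℝ} (hr : |r| < 1) :
    HasDerivAt (radialPotential g) (g |r| * (1 - r ^ 2)⁻¹) r := by
  have hc : ContinuousOn (fun t : ℝ => g |t| * (1 - t ^ 2)⁻¹) (Ioo (-1) 1) := by
    refine (hg.comp continuous_abs.continuousOn fun t ht => ⟨abs_nonneg t, abs_lt.2 ht⟩).mul ?_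
    refine ContinuousOn.inv₀ (by fun_prop) fun t ht => ?_
    nlinarith [ht.1, ht.2]
  have hr' : r ∈ Ioo (-1 : ℝ) 1 := abs_lt.1 hr
  have hnhds := isOpen_Ioo.mem_nhds hr'
  refine intervalIntegral.integral_hasDerivAt_right ?_
    (hc.stronglyMeasurableAtFilter isOpen_Ioo r hr') (hc.continuousAt hnhds)
  apply ContinuousOn.intervalIntegrable
  refine hc.mono ?_
  exact Set.ordConnected_Ioo.uIcc_subset (by norm_num) hr'

theorem continuousOn_radialPotential_norm (hg : ContinuousOn g (Ico 0 1)) :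
    ContinuousOn (fun z : EuclideanSpace ℝ (Fin n) => radialPotential g ‖z‖)
      (Metric.ball 0 1) := fun z hz =>
  ((hasDerivAt_radialPotential hg
    (by simpa using hz : |‖z‖| < 1)).continuousAt.comp
      continuous_norm.continuousAt).continuousWithinAt

theorem tendsto_radialPotential
    (hgint : Tendsto (fun ρ : ℝ => ∫ r in (0 : ℝ)..ρ, g r * (1 - r ^ 2)⁻¹) (𝓝[<] 1) atTop) :
    Tendsto (radialPotential g) (𝓝[<] 1) atTop := by
  refine hgint.congr' ?_
  filter_upwards [Ioo_mem_nhdsLT (zero_lt_one' ℝ)] with ρ hρ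
  refine intervalIntegral.integral_congr fun t ht => ?_
  rw [uIcc_of_le hρ.1.le] at ht
  simp [abs_of_nonneg ht.1]

/-- Chain rule for the radial potential along a curve, including curves through the origin, where
the norm is not differentiable: there the potential vanishes to first order since `g 0 = 0`. -/
theorem hasDerivAt_radialPotential_norm (hg : ContinuousOn g (Ico 0 1)) (hg0 : g 0 = 0)
    {c : ℝ → EuclideanSpace ℝ (Fin n)} {c' : EuclideanSpace ℝ (Fin n)} {t : ℝ}
    (hc : HasDerivAt c c' t) (hct : ‖c t‖ < 1) :
    HasDerivAt (fun s => radialPotential g ‖c s‖)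
      ((1 - ‖c t‖ ^ 2)⁻¹ * (g ‖c t‖ / ‖c t‖) * inner ℝ (c t) c') t := by
  have hG := hasDerivAt_radialPotential hg (r := ‖c t‖) (by simpa using hct)
  rcases eq_or_ne (c t) 0 with h0 | h0
  · simp only [h0, norm_zero, abs_zero, hg0, zero_mul, inner_zero_left, mul_zero] at hG ⊢
    have hlim : Tendsto (fun s => ‖c s‖) (𝓝 t) (𝓝 0) := by
      simpa [h0] using hc.continuousAt.norm.tendsto
    have h1 := hG.isLittleO.comp_tendsto hlim
    have h2 := hc.isBigO_sub
    rw [hasDerivAt_iff_isLittleO]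
    simp only [h0, sub_zero, norm_zero, smul_zero] at h1 h2 ⊢
    have h3 : (fun s => ‖c s‖) =O[𝓝 t] c :=
      Asymptotics.isBigO_norm_left.2 (Asymptotics.isBigO_refl c _)
    exact (h1.trans_isBigO h3).trans_isBigO h2
  · have hn : ‖c t‖ ≠ 0 := norm_ne_zero_iff.2 h0
    have hs := hc.norm_sq.sqrt (pow_ne_zero 2 hn)
    simp only [Real.sqrt_sq (norm_nonneg _)] at hs
    have := HasDerivAt.comp t hG hs
    refine this.congr_deriv ?_
    rw [abs_norm]
    field_simp

/-- The hyperbolic gradient identity: the potential of the radial field, transported by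
`moebius · y`, has Euclidean gradient `(1 - ‖x‖ ^ 2)⁻¹ • radialField g (moebius x y)`. -/
theorem hasDerivAt_radialPotential_moebius (hg : ContinuousOn g (Ico 0 1)) (hg0 : g 0 = 0)
    {x y u : EuclideanSpace ℝ (Fin n)} {t : ℝ} (hx : ‖x + t • u‖ < 1) (hy : ‖y‖ < 1) :
    HasDerivAt (fun s : ℝ => radialPotential g ‖moebius (x + s • u) y‖)
      ((1 - ‖x + t • u‖ ^ 2)⁻¹ * inner ℝ (radialField g (moebius (x + t • u) y)) u) t := by
  have key : ∀ z : EuclideanSpace ℝ (Fin n), ‖z‖ < 1 →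
      HasDerivAt (fun s : ℝ => radialPotential g ‖moebius (z + s • u) y‖)
      ((1 - ‖z‖ ^ 2)⁻¹ * inner ℝ (radialField g (moebius z y)) u) 0 := by
    intro z hz
    have hl : HasDerivAt (fun s : ℝ => z + s • u) u 0 := by
      simpa using ((hasDerivAt_id (0 : ℝ)).smul_const u).const_add z
    have hd : DifferentiableAt ℝ (fun s : ℝ => moebius (z + s • u) y) 0 :=
      DifferentiableAt.comp (0 : ℝ) (g := fun w => moebius w y)
        (by simpa using differentiableAt_moebius_left hz hy) hl.differentiableAt
    have hlt := norm_moebius_lt_one hz hy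
    have h := hasDerivAt_radialPotential_norm hg hg0 hd.hasDerivAt (by simpa using hlt)
    simp only [zero_smul, add_zero] at h
    refine h.congr_deriv ?_
    rw [inner_moebius_deriv hz hy hd.hasDerivAt, radialField, real_inner_smul_left]
    have h1 := (one_sub_norm_sq_pos hlt).ne'
    have h2 := (one_sub_norm_sq_pos hz).ne'
    field_simp
  have h := HasDerivAt.comp_sub_const t t (by simpa using key _ hx)
  refine h.congr_of_eventuallyEq (Eventually.of_forall fun s => ?_)
  simp only
  congr 3
  module

end Radial

/-! ### Integrability and existence of a zero -/

section Existence

variable {n : ℕ} {g : ℝ → ℝ} {Ω : Set (EuclideanSpace ℝ (Fin n))}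
  {W : EuclideanSpace ℝ (Fin n) → ℝ}

theorem continuousOn_comp_moebius {X : Type*} [TopologicalSpace X]
    {h : EuclideanSpace ℝ (Fin n) → X} (hh : ContinuousOn h (Metric.ball 0 1)) :
    ContinuousOn (fun p : EuclideanSpace ℝ (Fin n) × EuclideanSpace ℝ (Fin n) =>
      h (moebius p.1 p.2)) (Metric.ball 0 1 ×ˢ Metric.ball 0 1) :=
  hh.comp continuousOn_moebius mapsTo_moebius

theorem exists_norm_comp_moebius_le {X : Type*} [SeminormedAddCommGroup X]
    {h : EuclideanSpace ℝ (Fin n) → X} (hh : ContinuousOn h (Metric.ball 0 1))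
    {R₀ ρ : ℝ} (hR₀ : 0 ≤ R₀) (hR₀1 : R₀ < 1) (hρ : 0 ≤ ρ) (hρ1 : ρ < 1) :
    ∃ C, ∀ x y : EuclideanSpace ℝ (Fin n), ‖x‖ ≤ ρ → ‖y‖ ≤ R₀ → ‖h (moebius x y)‖ ≤ C := by
  obtain ⟨R, hR, hle⟩ := exists_norm_moebius_le (n := n) hρ hρ1 hR₀ hR₀1
  obtain ⟨C, hC⟩ := (isCompact_closedBall 0 R).exists_bound_of_continuousOn
    (hh.mono (Metric.closedBall_subset_ball hR))
  exact ⟨C, fun x y hx hy => hC _ (mem_closedBall_zero_iff.2 (hle x y hx hy))⟩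

theorem aestronglyMeasurable_smul_comp_moebius {X : Type*} [NormedAddCommGroup X]
    [NormedSpace ℝ X]
    {h : EuclideanSpace ℝ (Fin n) → X} (hh : ContinuousOn h (Metric.ball 0 1))
    (hΩ : IsOpen Ω) (hΩb : Ω ⊆ Metric.ball 0 1) (hW : IntegrableOn W Ω)
    {x : EuclideanSpace ℝ (Fin n)} (hx : ‖x‖ < 1) :
    AEStronglyMeasurable (fun y => W y • h (moebius x y)) (volume.restrict Ω) := by
  refine hW.aestronglyMeasurable.smul
    (ContinuousOn.aestronglyMeasurable ?_ hΩ.measurableSet)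
  exact (continuousOn_comp_moebius hh).comp (f := fun y => (x, y)) (by fun_prop)
    fun y hy => ⟨mem_ball_zero_iff.2 hx, hΩb hy⟩

theorem integrableOn_smul_comp_moebius {X : Type*} [NormedAddCommGroup X] [NormedSpace ℝ X]
    {h : EuclideanSpace ℝ (Fin n) → X} (hh : ContinuousOn h (Metric.ball 0 1))
    {R₀ : ℝ} (hR₀ : 0 ≤ R₀) (hR₀1 : R₀ < 1)
    (hΩ : IsOpen Ω) (hΩb : ∀ y ∈ Ω, ‖y‖ ≤ R₀) (hW : IntegrableOn W Ω)
    {x : EuclideanSpace ℝ (Fin n)} (hx : ‖x‖ < 1) :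
    IntegrableOn (fun y => W y • h (moebius x y)) Ω := by
  obtain ⟨C, hC⟩ := exists_norm_comp_moebius_le hh hR₀ hR₀1 (norm_nonneg x) hx
  refine (hW.norm.mul_const C).mono' (aestronglyMeasurable_smul_comp_moebius hh hΩ
    (fun y hy => mem_ball_zero_iff.2 ((hΩb y hy).trans_lt hR₀1)) hW hx) ?_
  filter_upwards [ae_restrict_mem hΩ.measurableSet] with y hy
  rw [norm_smul]
  gcongr
  exact hC x y le_rfl (hΩb y hy)

/-- The integral over `Ω`, with weight `W`, of the potential of the radial field based at `-y`,
evaluated at `x`. -/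
noncomputable def energy (g : ℝ → ℝ) (Ω : Set (EuclideanSpace ℝ (Fin n)))
    (W : EuclideanSpace ℝ (Fin n) → ℝ) (x : EuclideanSpace ℝ (Fin n)) : ℝ :=
  ∫ y in Ω, W y • radialPotential g ‖moebius x y‖

theorem continuousOn_energy (hg : ContinuousOn g (Ico 0 1)) {R₀ ρ : ℝ} (hR₀ : 0 ≤ R₀)
    (hR₀1 : R₀ < 1) (hΩ : IsOpen Ω) (hΩb : ∀ y ∈ Ω, ‖y‖ ≤ R₀) (hW : IntegrableOn W Ω)
    (hρ : 0 ≤ ρ) (hρ1 : ρ < 1) :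
    ContinuousOn (energy g Ω W) (Metric.closedBall 0 ρ) := by
  have hh := continuousOn_radialPotential_norm (n := n) hg
  have hΩb' : Ω ⊆ Metric.ball 0 1 := fun y hy => mem_ball_zero_iff.2 ((hΩb y hy).trans_lt hR₀1)
  have hsub : Metric.closedBall (0 : EuclideanSpace ℝ (Fin n)) ρ ⊆ Metric.ball 0 1 :=
    Metric.closedBall_subset_ball hρ1
  obtain ⟨C, hC⟩ := exists_norm_comp_moebius_le hh hR₀ hR₀1 hρ hρ1
  refine continuousOn_of_dominated (bound := fun y => ‖W y‖ * C)
    (fun x hx => aestronglyMeasurable_smul_comp_moebius hh hΩ hΩb' hW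
      (mem_ball_zero_iff.1 (hsub hx))) (fun x hx => ?_) (hW.norm.mul_const C) ?_
  · filter_upwards [ae_restrict_mem hΩ.measurableSet] with y hy
    rw [norm_smul]
    gcongr
    exact hC x y (mem_closedBall_zero_iff.1 hx) (hΩb y hy)
  · filter_upwards [ae_restrict_mem hΩ.measurableSet] with y hy
    refine ContinuousOn.const_smul (c := W y) ?_
    exact (continuousOn_comp_moebius hh).comp (f := fun x => (x, y)) (by fun_prop)
      fun x hx => ⟨hsub hx, hΩb' hy⟩

/-- Differentiation of the energy in the direction `u`, under the integral sign. -/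
theorem hasDerivAt_energy (hg : ContinuousOn g (Ico 0 1)) (hg0 : g 0 = 0) {R₀ : ℝ}
    (hR₀ : 0 ≤ R₀) (hR₀1 : R₀ < 1) (hΩ : IsOpen Ω) (hΩb : ∀ y ∈ Ω, ‖y‖ ≤ R₀)
    (hW : IntegrableOn W Ω) {x : EuclideanSpace ℝ (Fin n)} (hx : ‖x‖ < 1)
    (u : EuclideanSpace ℝ (Fin n)) :
    HasDerivAt (fun s : ℝ => energy g Ω W (x + s • u))
      ((1 - ‖x‖ ^ 2)⁻¹ * inner ℝ (∫ y in Ω, W y • radialField g (moebius x y)) u) 0 := by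
  have hh := continuousOn_radialPotential_norm (n := n) hg
  have hv := continuousOn_radialField (n := n) hg hg0
  have hΩb' : Ω ⊆ Metric.ball 0 1 := fun y hy => mem_ball_zero_iff.2 ((hΩb y hy).trans_lt hR₀1)
  obtain ⟨ρ, hxρ, hρ1⟩ := exists_between hx
  have hρ : 0 ≤ ρ := (norm_nonneg x).trans hxρ.le
  obtain ⟨C, hC⟩ := exists_norm_comp_moebius_le hv hR₀ hR₀1 hρ hρ1
  have hs : {s : ℝ | ‖x + s • u‖ < ρ} ∈ 𝓝 (0 : ℝ) :=
    (by fun_prop : Continuous fun s : ℝ => ‖x + s • u‖).continuousAt.eventually_lt_const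
      (by simpa using hxρ)
  have hvint := integrableOn_smul_comp_moebius hv hR₀ hR₀1 hΩ hΩb hW hx
  have hval : (∫ y in Ω, W y • ((1 - ‖x‖ ^ 2)⁻¹ * inner ℝ (radialField g (moebius x y)) u)) =
      (1 - ‖x‖ ^ 2)⁻¹ * inner ℝ (∫ y in Ω, W y • radialField g (moebius x y)) u := by
    rw [real_inner_comm, ← integral_inner hvint, ← integral_const_mul]
    refine integral_congr_ae (Eventually.of_forall fun y => ?_)
    simp only [real_inner_smul_right, smul_eq_mul, real_inner_comm u]
    ring
  rw [← hval]
  have hmain := (hasDerivAt_integral_of_dominated_loc_of_deriv_le (μ := volume.restrict Ω)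
    (F := fun (s : ℝ) y => W y • radialPotential g ‖moebius (x + s • u) y‖)
    (F' := fun (s : ℝ) y => W y • ((1 - ‖x + s • u‖ ^ 2)⁻¹ *
      inner ℝ (radialField g (moebius (x + s • u) y)) u))
    (x₀ := 0) (bound := fun y => ‖W y‖ * ((1 - ρ ^ 2)⁻¹ * (C * ‖u‖))) hs
    ?_ ?_ ?_ ?_ (hW.norm.mul_const _) ?_).2
  · simp only [zero_smul, add_zero] at hmain
    exact hmain
  · filter_upwards [hs] with s hs
    exact aestronglyMeasurable_smul_comp_moebius hh hΩ hΩb' hW (lt_trans hs hρ1)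
  · simpa [IntegrableOn] using integrableOn_smul_comp_moebius hh hR₀ hR₀1 hΩ hΩb hW hx
  · simp only [zero_smul, add_zero]
    exact aestronglyMeasurable_smul_comp_moebius
      (h := fun z => (1 - ‖x‖ ^ 2)⁻¹ * inner ℝ (radialField g z) u)
      (continuousOn_const.mul (hv.inner continuousOn_const)) hΩ hΩb' hW hx
  · filter_upwards [ae_restrict_mem hΩ.measurableSet] with y hy s hs
    have hs : ‖x + s • u‖ < ρ := hs
    have h0 : 0 < 1 - ρ ^ 2 := by nlinarith
    have h1 : 0 < 1 - ‖x + s • u‖ ^ 2 := one_sub_norm_sq_pos (hs.trans hρ1)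
    rw [norm_smul, norm_mul, Real.norm_of_nonneg (inv_nonneg.2 h1.le)]
    gcongr
    exact (norm_inner_le_norm _ _).trans (by gcongr; exact hC _ _ hs.le (hΩb y hy))
  · filter_upwards [ae_restrict_mem hΩ.measurableSet] with y hy s hs
    exact (hasDerivAt_radialPotential_moebius hg hg0 (lt_trans hs hρ1)
      (mem_ball_zero_iff.1 (hΩb' hy))).const_mul (W y)

/-- The energy is coercive: it exceeds any bound near the unit sphere. -/
theorem exists_lt_energy (hg : ContinuousOn g (Ico 0 1)) {R₀ : ℝ} (hR₀ : 0 ≤ R₀)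
    (hR₀1 : R₀ < 1) (hΩ : IsOpen Ω) (hΩb : ∀ y ∈ Ω, ‖y‖ ≤ R₀) (hW : IntegrableOn W Ω)
    (hW0 : ∀ y ∈ Ω, 0 ≤ W y) (hWpos : 0 < ∫ y in Ω, W y)
    (hG : Tendsto (radialPotential g) (𝓝[<] 1) atTop) (M : ℝ) :
    ∃ ρ, 0 ≤ ρ ∧ ρ < 1 ∧ ∀ x : EuclideanSpace ℝ (Fin n), ρ ≤ ‖x‖ → ‖x‖ < 1 →
      M < energy g Ω W x := by
  have hh := continuousOn_radialPotential_norm (n := n) hg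
  obtain ⟨K, hK⟩ := exists_gt (M / ∫ y in Ω, W y)
  have hev := hG.eventually_ge_atTop K
  obtain ⟨l, hl1, hl⟩ := (mem_nhdsLT_iff_exists_Ioo_subset).1 hev
  have hl1 : l < 1 := hl1
  -- `ρ ^ 2 = 1 - δ` with `δ` so small that `moebius x y` has norm greater than `max l 0`
  set m := max l 0 with hm
  have hm1 : m < 1 := max_lt hl1 one_pos
  have hm0 : 0 ≤ m := le_max_right _ _
  have hp : 0 < (1 - R₀) ^ 2 := pow_pos (sub_pos.2 hR₀1) 2
  have hp1 : (1 - R₀) ^ 2 ≤ 1 := by nlinarith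
  have hmm : 0 < 1 - m ^ 2 := by nlinarith
  set δ := (1 - m ^ 2) * (1 - R₀) ^ 2 / 2 with hδ
  have hδ0 : 0 < δ := by positivity
  have hδ1 : δ < 1 := by
    have : (1 - m ^ 2) * (1 - R₀) ^ 2 ≤ 1 * 1 :=
      mul_le_mul (by nlinarith) hp1 hp.le zero_le_one
    linarith
  refine ⟨√(1 - δ), Real.sqrt_nonneg _, ?_, fun x hρx hx => ?_⟩
  · rw [Real.sqrt_lt' one_pos]
    linarith
  · have hxδ : 1 - ‖x‖ ^ 2 ≤ δ := by
      have := (Real.sqrt_le_left (norm_nonneg x)).1 hρx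
      linarith
    have hpt : ∀ y ∈ Ω, W y * K ≤ W y • radialPotential g ‖moebius x y‖ := by
      intro y hy
      rw [smul_eq_mul]
      refine mul_le_mul_of_nonneg_left (hl ⟨?_, ?_⟩) (hW0 y hy)
      · have h1 := one_sub_norm_sq_moebius_le hR₀1 hx (hΩb y hy)
        have h2 : (1 - ‖x‖ ^ 2) / (1 - R₀) ^ 2 < 1 - m ^ 2 := by
          rw [div_lt_iff₀ hp]
          have : 0 < (1 - m ^ 2) * (1 - R₀) ^ 2 := by positivity
          linarith
        have h3 : m < ‖moebius x y‖ := by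
          refine lt_of_pow_lt_pow_left₀ 2 (norm_nonneg _) ?_
          linarith
        exact (le_max_left _ _).trans_lt h3
      · exact norm_moebius_lt_one hx ((hΩb y hy).trans_lt hR₀1)
    calc M < (∫ y in Ω, W y) * K := by rwa [div_lt_iff₀' hWpos] at hK
      _ = ∫ y in Ω, W y * K := (integral_mul_const _ _).symm
      _ ≤ energy g Ω W x := setIntegral_mono_on (hW.mul_const K)
        (integrableOn_smul_comp_moebius hh hR₀ hR₀1 hΩ hΩb hW hx) hΩ.measurableSet hpt

/-- A minimum point of the energy is a zero of the weighted mean of the radial field. -/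
theorem exists_integral_radialField_eq_zero (hg : ContinuousOn g (Ico 0 1)) (hg0 : g 0 = 0)
    {R₀ : ℝ} (hR₀ : 0 ≤ R₀) (hR₀1 : R₀ < 1) (hΩ : IsOpen Ω) (hΩb : ∀ y ∈ Ω, ‖y‖ ≤ R₀)
    (hW : IntegrableOn W Ω) (hW0 : ∀ y ∈ Ω, 0 ≤ W y) (hWpos : 0 < ∫ y in Ω, W y)
    (hG : Tendsto (radialPotential g) (𝓝[<] 1) atTop) :
    ∃ x ∈ Metric.ball (0 : EuclideanSpace ℝ (Fin n)) 1,
      ∫ y in Ω, W y • radialField g (moebius x y) = 0 := by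
  obtain ⟨ρ, hρ0, hρ1, hρ⟩ := exists_lt_energy hg hR₀ hR₀1 hΩ hΩb hW hW0 hWpos hG
    (energy g Ω W 0)
  obtain ⟨x, hx, hmin⟩ := (isCompact_closedBall (0 : EuclideanSpace ℝ (Fin n)) ρ).exists_isMinOn
    ⟨0, by simpa using hρ0⟩ (continuousOn_energy hg hR₀ hR₀1 hΩ hΩb hW hρ0 hρ1)
  have hxle : ‖x‖ ≤ ρ := mem_closedBall_zero_iff.1 hx
  have hx1 := hxle.trans_lt hρ1
  have hxlt : ‖x‖ < ρ := by
    by_contra! h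
    exact absurd (hmin (mem_closedBall_zero_iff.2 (by simpa using hρ0))) (not_le.2 (hρ x h hx1))
  refine ⟨x, mem_ball_zero_iff.2 hx1, ?_⟩
  refine ext_inner_right ℝ fun u => ?_
  have hloc : IsLocalMin (fun s : ℝ => energy g Ω W (x + s • u)) 0 := by
    have : ∀ᶠ s : ℝ in 𝓝 0, ‖x + s • u‖ < ρ :=
      (by fun_prop : Continuous fun s : ℝ => ‖x + s • u‖).continuousAt.eventually_lt_const
        (by simpa using hxlt)
    filter_upwards [this] with s hs
    simpa using hmin (mem_closedBall_zero_iff.2 hs.le)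
  have h := hloc.hasDerivAt_eq_zero (hasDerivAt_energy hg hg0 hR₀ hR₀1 hΩ hΩb hW hx1 u)
  rw [inner_zero_left]
  exact (mul_eq_zero.1 h).resolve_left (inv_ne_zero (one_sub_norm_sq_pos hx1).ne')

end Existence

/-! ### Hyperbolic trigonometry -/

section HypTrig

variable {n : ℕ} {x x₁ x₂ y : EuclideanSpace ℝ (Fin n)}

/-- The hyperbolic cosine of the distance between `-x` and `y` in the metric of curvature `-1`,
that is, `(1 + ‖z‖ ^ 2) / (1 - ‖z‖ ^ 2)` for `z = moebius x y`. -/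
noncomputable def hypCosh (x y : EuclideanSpace ℝ (Fin n)) : ℝ :=
  ((1 + ‖x‖ ^ 2) * (1 + ‖y‖ ^ 2) + 4 * inner ℝ x y) / ((1 - ‖x‖ ^ 2) * (1 - ‖y‖ ^ 2))

/-- The spatial part `2 z / (1 - ‖z‖ ^ 2)` of the point of the hyperboloid corresponding to
`z = moebius x y`; its norm is the hyperbolic sine of the distance between `-x` and `y`. -/
noncomputable def hypVec (x y : EuclideanSpace ℝ (Fin n)) : EuclideanSpace ℝ (Fin n) :=
  (2 / ((1 - ‖x‖ ^ 2) * (1 - ‖y‖ ^ 2))) • moebiusNum x y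

theorem hypCosh_eq (hx : ‖x‖ < 1) (hy : ‖y‖ < 1) :
    hypCosh x y = 2 / (1 - ‖moebius x y‖ ^ 2) - 1 := by
  have hd := moebiusDenom_pos hx hy
  have h1 := one_sub_norm_sq_pos hx
  have h2 := one_sub_norm_sq_pos hy
  rw [one_sub_norm_sq_moebius hx hy, hypCosh]
  have hexp : moebiusDenom x y = 1 + 2 * inner ℝ x y + ‖x‖ ^ 2 * ‖y‖ ^ 2 := rfl
  field_simp
  rw [hexp]
  ring

theorem hypVec_eq (hx : ‖x‖ < 1) (hy : ‖y‖ < 1) :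
    hypVec x y = (2 / (1 - ‖moebius x y‖ ^ 2)) • moebius x y := by
  have hd := moebiusDenom_pos hx hy
  have h1 := one_sub_norm_sq_pos hx
  have h2 := one_sub_norm_sq_pos hy
  rw [one_sub_norm_sq_moebius hx hy, hypVec, moebius_eq, smul_smul]
  congr 1
  field_simp

theorem norm_hypVec (hx : ‖x‖ < 1) (hy : ‖y‖ < 1) :
    ‖hypVec x y‖ = 2 / (1 - ‖moebius x y‖ ^ 2) * ‖moebius x y‖ := by
  have h := one_sub_norm_sq_pos (norm_moebius_lt_one hx hy)
  rw [hypVec_eq hx hy, norm_smul, Real.norm_of_nonneg (by positivity)]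

theorem norm_hypVec_sq (hx : ‖x‖ < 1) (hy : ‖y‖ < 1) :
    ‖hypVec x y‖ ^ 2 = hypCosh x y ^ 2 - 1 := by
  have h := one_sub_norm_sq_pos (norm_moebius_lt_one hx hy)
  rw [norm_hypVec hx hy, hypCosh_eq hx hy]
  field_simp
  ring

theorem one_le_hypCosh (hx : ‖x‖ < 1) (hy : ‖y‖ < 1) : 1 ≤ hypCosh x y := by
  have h := one_sub_norm_sq_pos (norm_moebius_lt_one hx hy)
  have h2 : 2 ≤ 2 / (1 - ‖moebius x y‖ ^ 2) := by
    rw [le_div_iff₀ h]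
    nlinarith [sq_nonneg ‖moebius x y‖]
  rw [hypCosh_eq hx hy]
  linarith

theorem one_lt_hypCosh_neg (hx₁ : ‖x₁‖ < 1) (hx₂ : ‖x₂‖ < 1) (hne : x₁ ≠ x₂) :
    1 < hypCosh (-x₁) x₂ := by
  have h1 := one_sub_norm_sq_pos hx₁
  have h2 := one_sub_norm_sq_pos hx₂
  have h3 : 0 < ‖x₁ - x₂‖ ^ 2 := pow_pos (norm_pos_iff.2 (sub_ne_zero.2 hne)) 2
  rw [norm_sub_sq_real] at h3
  rw [hypCosh, norm_neg, inner_neg_left, one_lt_div (mul_pos h1 h2)]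
  linarith

theorem hypCosh_neg_comm (x₁ x₂ : EuclideanSpace ℝ (Fin n)) :
    hypCosh (-x₁) x₂ = hypCosh (-x₂) x₁ := by
  simp only [hypCosh, norm_neg, inner_neg_left, real_inner_comm x₁ x₂]
  congr 1 <;> ring

/-- The hyperbolic law of cosines in the triangle with vertices `x₁`, `x₂` and `-y`, whose angle at
`x₁` is that between `-hypVec x₁ y` and `hypVec (-x₁) x₂`. -/
theorem inner_hypVec (hx₁ : ‖x₁‖ < 1) (hx₂ : ‖x₂‖ < 1) (hy : ‖y‖ < 1) :
    inner ℝ (hypVec x₁ y) (hypVec (-x₁) x₂) =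
      hypCosh x₂ y - hypCosh (-x₁) x₂ * hypCosh x₁ y := by
  have h1 := one_sub_norm_sq_pos hx₁
  have h2 := one_sub_norm_sq_pos hx₂
  have h3 := one_sub_norm_sq_pos hy
  simp only [hypVec, hypCosh, moebiusNum, norm_neg, inner_neg_left, inner_neg_right,
    inner_add_left, inner_add_right, real_inner_smul_left,
    real_inner_smul_right, real_inner_self_eq_norm_sq, real_inner_comm x₁ y,
    real_inner_comm x₂ y]
  field_simp
  ring

theorem radialField_moebius (g : ℝ → ℝ) (hx : ‖x‖ < 1) (hy : ‖y‖ < 1) :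
    radialField g (moebius x y) = (g ‖moebius x y‖ / ‖hypVec x y‖) • hypVec x y := by
  have h := one_sub_norm_sq_pos (norm_moebius_lt_one hx hy)
  rw [norm_hypVec hx hy, hypVec_eq hx hy, radialField, smul_smul]
  congr 1
  field_simp

theorem norm_moebius_le_of_hypCosh_le (hx₁ : ‖x₁‖ < 1) (hx₂ : ‖x₂‖ < 1) (hy : ‖y‖ < 1)
    (h : hypCosh x₁ y ≤ hypCosh x₂ y) : ‖moebius x₁ y‖ ≤ ‖moebius x₂ y‖ := by
  have h1 := one_sub_norm_sq_pos (norm_moebius_lt_one hx₁ hy)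
  have h2 := one_sub_norm_sq_pos (norm_moebius_lt_one hx₂ hy)
  rw [hypCosh_eq hx₁ hy, hypCosh_eq hx₂ hy, sub_le_sub_iff_right,
    div_le_div_iff_of_pos_left two_pos h1 h2] at h
  exact le_of_sq_le_sq (by linarith) (norm_nonneg _)

theorem norm_moebius_lt_of_hypCosh_lt (hx₁ : ‖x₁‖ < 1) (hx₂ : ‖x₂‖ < 1) (hy : ‖y‖ < 1)
    (h : hypCosh x₁ y < hypCosh x₂ y) : ‖moebius x₁ y‖ < ‖moebius x₂ y‖ := by
  refine lt_of_le_of_ne (norm_moebius_le_of_hypCosh_le hx₁ hx₂ hy h.le) fun heq => ?_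
  rw [hypCosh_eq hx₁ hy, hypCosh_eq hx₂ hy, heq] at h
  exact lt_irrefl _ h

/-- The Gram determinant of the hyperboloid points with pairwise products `A₁`, `A₂`, `c`. -/
noncomputable def hypGram (c A₁ A₂ : ℝ) : ℝ := 1 + 2 * c * A₁ * A₂ - A₁ ^ 2 - A₂ ^ 2 - c ^ 2

theorem hypGram_eq (hx₁ : ‖x₁‖ < 1) (hx₂ : ‖x₂‖ < 1) (hy : ‖y‖ < 1) :
    hypGram (hypCosh (-x₁) x₂) (hypCosh x₁ y) (hypCosh x₂ y) =
      ‖hypVec (-x₁) x₂‖ ^ 2 * ‖hypVec x₁ y‖ ^ 2 -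
        inner ℝ (hypVec x₁ y) (hypVec (-x₁) x₂) ^ 2 := by
  rw [inner_hypVec hx₁ hx₂ hy, norm_hypVec_sq hx₁ hy,
    norm_hypVec_sq (by rwa [norm_neg]) hx₂, hypGram]
  ring

theorem hypGram_nonneg (hx₁ : ‖x₁‖ < 1) (hx₂ : ‖x₂‖ < 1) (hy : ‖y‖ < 1) :
    0 ≤ hypGram (hypCosh (-x₁) x₂) (hypCosh x₁ y) (hypCosh x₂ y) := by
  rw [hypGram_eq hx₁ hx₂ hy]
  have := real_inner_mul_inner_self_le (hypVec x₁ y) (hypVec (-x₁) x₂)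
  simp only [real_inner_self_eq_norm_sq] at this
  linarith

/-- Convexity along a geodesic in scalar form. In a hyperbolic triangle with two vertices at
distances `d₁ ≤ d₂` from the third, take at these vertices vectors of length `g₁ ≤ g₂` pointing
away from the third one. Their components along the side joining the two vertices, each in the
direction of the other vertex, have a strictly negative sum: only the angle at the nearer vertex may
be obtuse, and then the angle at the farther one is smaller than its supplement. Here `A₁`, `A₂`, `c`
are the hyperbolic cosines of the sides and `S₁`, `S₂` the hyperbolic sines of `d₁`, `d₂`; the
common factor `1 / √(c ^ 2 - 1)` of the components is omitted. -/
theorem radial_speed_add_neg {c A₁ A₂ S₁ S₂ g₁ g₂ : ℝ} (hc : 1 < c) (hA₁ : 1 ≤ A₁)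
    (hA : A₁ ≤ A₂) (hS₁ : 0 ≤ S₁) (hS₂ : 0 ≤ S₂) (hSA₁ : S₁ ^ 2 = A₁ ^ 2 - 1)
    (hSA₂ : S₂ ^ 2 = A₂ ^ 2 - 1) (hg₁ : 0 ≤ g₁) (hg : g₁ ≤ g₂) (hg₂ : 0 < S₂ → 0 < g₂)
    (hΓ : 0 ≤ hypGram c A₁ A₂) (hstrict : 0 < hypGram c A₁ A₂ ∨ (A₁ < A₂ → g₁ < g₂)) :
    g₁ / S₁ * (A₂ - c * A₁) + g₂ / S₂ * (A₁ - c * A₂) < 0 := by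
  have hP : 0 < c * A₂ - A₁ := by nlinarith
  have hS₂pos : 0 < S₂ := by
    refine lt_of_le_of_ne hS₂ fun h => ?_
    have h2 : A₂ = 1 := by nlinarith
    have h1 : A₁ = 1 := by linarith
    rw [hypGram, h1, h2] at hΓ
    nlinarith
  have hg₂pos := hg₂ hS₂pos
  have hsecond : 0 < g₂ / S₂ * (c * A₂ - A₁) := by positivity
  rcases le_or_gt A₂ (c * A₁) with hQ | hQ
  · have : g₁ / S₁ * (A₂ - c * A₁) ≤ 0 :=
      mul_nonpos_of_nonneg_of_nonpos (div_nonneg hg₁ hS₁) (by linarith)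
    linarith
  rcases hS₁.eq_or_lt with h0 | hS₁pos
  · rw [← h0, div_zero, zero_mul]
    linarith
  have hAlt : A₁ < A₂ := by nlinarith
  have hQ' : 0 < A₂ - c * A₁ := by linarith
  have hSlt : 0 < S₂ ^ 2 - S₁ ^ 2 := by nlinarith
  have hid : (c * A₂ - A₁) ^ 2 * S₁ ^ 2 - (A₂ - c * A₁) ^ 2 * S₂ ^ 2 =
      hypGram c A₁ A₂ * (S₂ ^ 2 - S₁ ^ 2) := by
    rw [hSA₁, hSA₂, hypGram]
    ring
  suffices h : g₁ * ((A₂ - c * A₁) / S₁) < g₂ * ((c * A₂ - A₁) / S₂) by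
    have e1 : g₁ / S₁ * (A₂ - c * A₁) = g₁ * ((A₂ - c * A₁) / S₁) := by ring
    have e2 : g₂ / S₂ * (A₁ - c * A₂) = -(g₂ * ((c * A₂ - A₁) / S₂)) := by ring
    linarith
  rcases hstrict with hΓ' | hlt
  · have : (A₂ - c * A₁) / S₁ < (c * A₂ - A₁) / S₂ := by
      rw [div_lt_div_iff₀ hS₁pos hS₂pos]
      refine lt_of_pow_lt_pow_left₀ 2 (by positivity) ?_
      have := mul_pos hΓ' hSlt
      rw [mul_pow, mul_pow]
      linarith
    calc _ ≤ g₂ * ((A₂ - c * A₁) / S₁) := by gcongr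
      _ < _ := by gcongr
  · have : (A₂ - c * A₁) / S₁ ≤ (c * A₂ - A₁) / S₂ := by
      rw [div_le_div_iff₀ hS₁pos hS₂pos]
      refine le_of_sq_le_sq ?_ (by positivity)
      have := mul_nonneg hΓ hSlt.le
      rw [mul_pow, mul_pow]
      linarith
    calc _ < g₂ * ((A₂ - c * A₁) / S₁) := by
          have := hlt hAlt
          gcongr
      _ ≤ _ := by gcongr

/-- Strict monotonicity of the derivative of the radial potential between the endpoints of the
geodesic segment from `x₁` to `x₂`: the vectors `hypVec (-x₁) x₂` at `x₁` and `hypVec (-x₂) x₁` at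
`x₂` have equal length and are tangent to the segment, each pointing to the other endpoint. -/
theorem inner_radialField_add_neg {g : ℝ → ℝ} (hg0 : g 0 = 0) (hmono : MonotoneOn g (Ico 0 1))
    (hpos : ∀ r ∈ Ioo (0 : ℝ) 1, 0 < g r) (hx₁ : ‖x₁‖ < 1) (hx₂ : ‖x₂‖ < 1) (hne : x₁ ≠ x₂)
    (hy : ‖y‖ < 1)
    (hstrict : 0 < hypGram (hypCosh (-x₁) x₂) (hypCosh x₁ y) (hypCosh x₂ y) ∨
      StrictMonoOn g (Ico 0 1)) :
    inner ℝ (radialField g (moebius x₁ y)) (hypVec (-x₁) x₂) +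
      inner ℝ (radialField g (moebius x₂ y)) (hypVec (-x₂) x₁) < 0 := by
  -- the statement is symmetric, so the vertex nearer to `-y` may be taken to be the first
  wlog hA : hypCosh x₁ y ≤ hypCosh x₂ y generalizing x₁ x₂
  · rw [add_comm]
    refine this hx₂ hx₁ hne.symm (hstrict.imp_left fun h => ?_) (le_of_not_ge hA)
    rw [hypCosh_neg_comm]
    refine h.trans_eq ?_
    unfold hypGram
    ring
  have hm : ∀ x, ‖x‖ < 1 → ‖moebius x y‖ ∈ Ico (0 : ℝ) 1 := fun x hx =>
    ⟨norm_nonneg _, norm_moebius_lt_one hx hy⟩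
  rw [radialField_moebius g hx₁ hy, radialField_moebius g hx₂ hy, real_inner_smul_left,
    real_inner_smul_left, inner_hypVec hx₁ hx₂ hy, inner_hypVec hx₂ hx₁ hy,
    hypCosh_neg_comm x₂ x₁]
  refine radial_speed_add_neg (one_lt_hypCosh_neg hx₁ hx₂ hne) (one_le_hypCosh hx₁ hy) hA
    (norm_nonneg _) (norm_nonneg _) (norm_hypVec_sq hx₁ hy) (norm_hypVec_sq hx₂ hy) ?_
    (hmono (hm _ hx₁) (hm _ hx₂) (norm_moebius_le_of_hypCosh_le hx₁ hx₂ hy hA)) (fun h => ?_)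
    (hypGram_nonneg hx₁ hx₂ hy) (hstrict.imp_right fun h hlt => ?_)
  · rw [← hg0]
    exact hmono ⟨le_rfl, one_pos⟩ (hm _ hx₁) (norm_nonneg _)
  · refine hpos _ ⟨lt_of_le_of_ne (norm_nonneg _) fun h0 => ?_, norm_moebius_lt_one hx₂ hy⟩
    rw [norm_hypVec hx₂ hy, ← h0, mul_zero] at h
    exact lt_irrefl _ h
  · exact h (hm _ hx₁) (hm _ hx₂) (norm_moebius_lt_of_hypCosh_lt hx₁ hx₂ hy hlt)

end HypTrig

/-! ### Uniqueness of the zero -/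

section Uniqueness

variable {n : ℕ} {x x₁ x₂ : EuclideanSpace ℝ (Fin n)}

/-- The preimage of a hyperplane through the origin under a Möbius translation lies in a hyperplane
or a sphere, hence is a null set. -/
theorem volume_inner_moebiusNum_eq_zero (hx : ‖x‖ < 1)
    {e : EuclideanSpace ℝ (Fin n)} (he : e ≠ 0) :
    volume {y : EuclideanSpace ℝ (Fin n) | inner ℝ (moebiusNum x y) e = 0} = 0 := by
  have hx' := one_sub_norm_sq_pos hx
  have : Nontrivial (EuclideanSpace ℝ (Fin n)) := ⟨⟨e, 0, he⟩⟩
  by_cases hα : (inner ℝ x e : ℝ) = 0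
  · refine measure_mono_null (fun y hy => ?_)
      (Measure.addHaar_submodule volume (Submodule.span ℝ {e})ᗮ ?_)
    · simp only [mem_ofPred_eq, moebiusNum, inner_add_left, real_inner_smul_left, hα, mul_zero,
        zero_add, mul_eq_zero, hx'.ne', false_or] at hy
      rw [SetLike.mem_coe, Submodule.mem_orthogonal_singleton_iff_inner_left]
      exact hy
    · intro h
      have : e ∈ (Submodule.span ℝ {e})ᗮ := h ▸ Submodule.mem_top
      rw [Submodule.mem_orthogonal_singleton_iff_inner_left, inner_self_eq_zero] at this
      exact he this
  · -- completing the square turns the equation into that of a sphere with centre `-m`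
    set m := x + ((1 - ‖x‖ ^ 2) / (2 * inner ℝ x e)) • e with hm
    refine measure_mono_null (fun y hy => ?_)
      (Measure.addHaar_sphere volume (-m) (√(‖m‖ ^ 2 - 1)))
    simp only [mem_ofPred_eq, moebiusNum, inner_add_left, real_inner_smul_left] at hy
    rw [mem_sphere_iff_norm, sub_neg_eq_add]
    have h : ‖y + m‖ ^ 2 = ‖m‖ ^ 2 - 1 := by
      rw [norm_add_sq_real, hm, inner_add_right, real_inner_smul_right, real_inner_comm x y]
      field_simp
      linear_combination hy
    rw [← h, Real.sqrt_sq (norm_nonneg _)]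

theorem ae_hypGram_pos (hn : 2 ≤ n) (hx₁ : ‖x₁‖ < 1) (hx₂ : ‖x₂‖ < 1) (hne : x₁ ≠ x₂) :
    ∀ᵐ y : EuclideanSpace ℝ (Fin n), ‖y‖ < 1 →
      0 < hypGram (hypCosh (-x₁) x₂) (hypCosh x₁ y) (hypCosh x₂ y) := by
  -- the Gram determinant vanishes only if `hypVec x₁ y` is parallel to `u`, so orthogonal to `e`
  set u := hypVec (-x₁) x₂ with hu
  have hu0 : u ≠ 0 := by
    intro h
    have h1 := norm_hypVec_sq (x := -x₁) (by rwa [norm_neg]) hx₂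
    rw [← hu, h, norm_zero] at h1
    nlinarith [one_lt_hypCosh_neg hx₁ hx₂ hne]
  obtain ⟨e, heu, he⟩ : ∃ e ∈ (Submodule.span ℝ {u})ᗮ, e ≠ 0 := by
    refine Submodule.exists_mem_ne_zero_of_ne_bot fun h => ?_
    rw [Submodule.orthogonal_eq_bot_iff] at h
    have h1 := finrank_span_singleton (K := ℝ) hu0
    rw [h, finrank_top, finrank_euclideanSpace_fin] at h1
    omega
  rw [Submodule.mem_orthogonal_singleton_iff_inner_right] at heu
  have hnull := volume_inner_moebiusNum_eq_zero hx₁ he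
  rw [measure_eq_zero_iff_ae_notMem] at hnull
  filter_upwards [hnull] with y hy hy1
  refine lt_of_le_of_ne (hypGram_nonneg hx₁ hx₂ hy1) fun h => hy ?_
  rw [hypGram_eq hx₁ hx₂ hy1, ← hu] at h
  -- equality in the Cauchy–Schwarz inequality
  have hz : ‖u‖ ^ 2 • hypVec x₁ y - inner ℝ (hypVec x₁ y) u • u = 0 := by
    rw [← norm_eq_zero, ← sq_eq_zero_iff, ← real_inner_self_eq_norm_sq]
    simp only [inner_sub_left, inner_sub_right, real_inner_smul_left, real_inner_smul_right,
      real_inner_self_eq_norm_sq, real_inner_comm (hypVec x₁ y) u, norm_smul, mul_pow,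
      Real.norm_eq_abs, sq_abs]
    linear_combination (-‖u‖ ^ 2) * h
  have h2 := congrArg (fun z => (inner ℝ z e : ℝ)) hz
  simp only [inner_sub_left, real_inner_smul_left, heu, mul_zero, sub_zero, inner_zero_left,
    hypVec] at h2
  have h3 := one_sub_norm_sq_pos hx₁
  have h4 := one_sub_norm_sq_pos hy1
  have h5 : ‖u‖ ^ 2 ≠ 0 := pow_ne_zero 2 (norm_ne_zero_iff.2 hu0)
  have h6 : 2 / ((1 - ‖x₁‖ ^ 2) * (1 - ‖y‖ ^ 2)) ≠ 0 := by positivity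
  exact (mul_eq_zero.1 ((mul_eq_zero.1 h2).resolve_left h5)).resolve_left h6

theorem eq_of_integral_radialField_eq_zero {g : ℝ → ℝ} {Ω : Set (EuclideanSpace ℝ (Fin n))}
    {W : EuclideanSpace ℝ (Fin n) → ℝ} (hg0 : g 0 = 0) (hmono : MonotoneOn g (Ico 0 1))
    (hpos : ∀ r ∈ Ioo (0 : ℝ) 1, 0 < g r) (hstrict : 2 ≤ n ∨ StrictMonoOn g (Ico 0 1))
    (hΩ : IsOpen Ω) (hΩb : Ω ⊆ Metric.ball 0 1) (hW0 : ∀ y ∈ Ω, 0 ≤ W y)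
    (hWpos : 0 < ∫ y in Ω, W y) (hx₁ : ‖x₁‖ < 1) (hx₂ : ‖x₂‖ < 1)
    (hint₁ : IntegrableOn (fun y => W y • radialField g (moebius x₁ y)) Ω)
    (hint₂ : IntegrableOn (fun y => W y • radialField g (moebius x₂ y)) Ω)
    (hz₁ : ∫ y in Ω, W y • radialField g (moebius x₁ y) = 0)
    (hz₂ : ∫ y in Ω, W y • radialField g (moebius x₂ y) = 0) : x₁ = x₂ := by
  by_contra hne
  set F : EuclideanSpace ℝ (Fin n) → ℝ := fun y =>
    inner ℝ (radialField g (moebius x₁ y)) (hypVec (-x₁) x₂) +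
      inner ℝ (radialField g (moebius x₂ y)) (hypVec (-x₂) x₁) with hF
  have hneg : ∀ᵐ y ∂(volume.restrict Ω), F y < 0 := by
    have hae : ∀ᵐ y : EuclideanSpace ℝ (Fin n), ‖y‖ < 1 →
        0 < hypGram (hypCosh (-x₁) x₂) (hypCosh x₁ y) (hypCosh x₂ y) ∨
          StrictMonoOn g (Ico 0 1) := by
      rcases hstrict with hn | hs
      · filter_upwards [ae_hypGram_pos hn hx₁ hx₂ hne] with y hy h
        exact Or.inl (hy h)
      · exact Eventually.of_forall fun y _ => Or.inr hs
    filter_upwards [ae_restrict_of_ae hae, ae_restrict_mem hΩ.measurableSet] with y hy hyΩ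
    have hy1 := mem_ball_zero_iff.1 (hΩb hyΩ)
    exact inner_radialField_add_neg hg0 hmono hpos hx₁ hx₂ hne hy1 (hy hy1)
  have heq : ∀ y, -(W y * F y) =
      -(inner ℝ (hypVec (-x₁) x₂) (W y • radialField g (moebius x₁ y)) +
      inner ℝ (hypVec (-x₂) x₁) (W y • radialField g (moebius x₂ y))) := fun y => by
    simp only [hF, real_inner_smul_right, real_inner_comm (hypVec (-x₁) x₂),
      real_inner_comm (hypVec (-x₂) x₁)]
    ring
  have hi₁ := hint₁.const_inner (𝕜 := ℝ) (hypVec (-x₁) x₂)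
  have hi₂ := hint₂.const_inner (𝕜 := ℝ) (hypVec (-x₂) x₁)
  have hint : IntegrableOn (fun y => -(W y * F y)) Ω := by
    simp only [heq]
    exact (hi₁.add hi₂).neg
  have hzero : ∫ y in Ω, -(W y * F y) = 0 := by
    simp only [heq]
    rw [integral_neg, integral_add hi₁ hi₂, integral_inner hint₁, integral_inner hint₂, hz₁, hz₂]
    simp
  have hnn : 0 ≤ᵐ[volume.restrict Ω] fun y => -(W y * F y) := by
    filter_upwards [hneg, ae_restrict_mem hΩ.measurableSet] with y hy hyΩ
    exact neg_nonneg.2 (mul_nonpos_of_nonneg_of_nonpos (hW0 y hyΩ) hy.le)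
  have hW : W =ᵐ[volume.restrict Ω] 0 := by
    filter_upwards [(integral_eq_zero_iff_of_nonneg_ae hnn hint).1 hzero, hneg] with y hy hFy
    exact (mul_eq_zero.1 (neg_eq_zero.1 hy)).resolve_right hFy.ne
  rw [integral_congr_ae hW] at hWpos
  simp at hWpos

end Uniqueness

theorem mainTheorem7 (n : ℕ) (hn : 1 ≤ n)
    (g : ℝ → ℝ) (hg : ContinuousOn g (Ico 0 1)) (hg0 : g 0 = 0)
    (Ω : Set (EuclideanSpace ℝ (Fin n))) (hΩ : IsOpen Ω)
    (hΩc : IsCompact (closure Ω)) (hΩb : closure Ω ⊆ Metric.ball 0 1)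
    (f : EuclideanSpace ℝ (Fin n) → ℝ) (hf : ∀ y ∈ Ω, 0 ≤ f y)
    (hfint : IntegrableOn (fun y => f y * hypDensity y) Ω volume)
    (hfpos : 0 < ∫ y in Ω, f y * hypDensity y)
    (hgint : Tendsto (fun ρ : ℝ => ∫ r in (0 : ℝ)..ρ, g r * (1 - r ^ 2)⁻¹) (𝓝[<] 1) atTop) :
    (∀ x ∈ Metric.ball (0 : EuclideanSpace ℝ (Fin n)) 1,
      IntegrableOn (fun y => (f y * hypDensity y) • radialField g (moebius x y)) Ω volume) ∧
    (∃ x ∈ Metric.ball (0 : EuclideanSpace ℝ (Fin n)) 1,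
      ∫ y in Ω, (f y * hypDensity y) • radialField g (moebius x y) = 0) ∧
    (MonotoneOn g (Ico 0 1) → (∀ r ∈ Ioo (0 : ℝ) 1, 0 < g r) →
      (2 ≤ n ∨ StrictMonoOn g (Ico 0 1)) →
      ∃! x : EuclideanSpace ℝ (Fin n), x ∈ Metric.ball 0 1 ∧
        ∫ y in Ω, (f y * hypDensity y) • radialField g (moebius x y) = 0) := by
  obtain ⟨R₀, ⟨hR₀, hR₀1⟩, hsub⟩ := exists_pos_lt_subset_ball one_pos isClosed_closure hΩb
  have hΩR : ∀ y ∈ Ω, ‖y‖ ≤ R₀ := fun y hy =>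
    (mem_ball_zero_iff.1 (hsub (subset_closure hy))).le
  have hW0 : ∀ y ∈ Ω, 0 ≤ f y * hypDensity y := fun y hy =>
    mul_nonneg (hf y hy)
      (zpow_nonneg (one_sub_norm_sq_pos ((hΩR y hy).trans_lt hR₀1)).le _)
  have hint : ∀ x ∈ Metric.ball (0 : EuclideanSpace ℝ (Fin n)) 1,
      IntegrableOn (fun y => (f y * hypDensity y) • radialField g (moebius x y)) Ω volume :=
    fun x hx => integrableOn_smul_comp_moebius (continuousOn_radialField hg hg0) hR₀.le hR₀1 hΩ
      hΩR hfint (mem_ball_zero_iff.1 hx)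
  obtain ⟨x, hx, hx0⟩ := exists_integral_radialField_eq_zero hg hg0 hR₀.le hR₀1 hΩ hΩR hfint hW0
    hfpos (tendsto_radialPotential hgint)
  refine ⟨hint, ⟨x, hx, hx0⟩, fun hmono hpos hstrict => ⟨x, ⟨hx, hx0⟩, fun z hz => ?_⟩⟩
  exact eq_of_integral_radialField_eq_zero hg0 hmono hpos hstrict hΩ
    (subset_closure.trans hΩb) hW0 hfpos (mem_ball_zero_iff.1 hz.1) (mem_ball_zero_iff.1 hx)
    (hint z hz.1) (hint x hx) hz.2 hx0
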